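/- Let $C$ be a field of characteristic zero and let $A$ be a commutative $C$-algebra with identity that is an integral domain. For $\lambda\in C$, let \[ Ш_C(A)=Ш_{C,\lambda}(A)=\bigoplus_{k\ge 0}A^{\otimes (k+1)} \] (tensor products over $C$) be the shuffle Baxter algebra of weight $\lambda$ on $A$. Its product is the mixed shuffle product, i.e. the bilinear product given on pure tensors $x=x_0\otimes x_1\otimes\cdots\otimes x_m$, $y=y_0\otimes y_1\otimes\cdots\otimes y_n$ by \[ x\,y=\sum_{(\sigma,T)}\lambda^{|T|}\;x_0y_0\otimes\sigma(x^+\otimes y^+;T). \] Here $x^+=x_1\otimes\cdots\otimes x_m$ and $y^+=y_1\otimes\cdots\otimes y_n$. The sum runs over all pairs $(\sigma,T)$ where $\sigma\in S_{m+n}$ satisfies $\sigma^{-1}(1)<\cdots<\sigma^{-1}(m)$ and $\sigma^{-1}(m+1)<\cdots<\sigma^{-1}(m+n)$, and where $T$ is a set of pairs $(k,k+1)$ with $1\le k<m+n$ and $\sigma(k)\le m<\sigma(k+1)$. With $u=(x_1,\dots,x_m,y_1,\dots,y_n)$, the tensor $\sigma(x^+\otimes y^+;T)\in A^{\otimes(m+n-|T|)}$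 is obtained from $u_{\sigma(1)}\otimes\cdots\otimes u_{\sigma(m+n)}$ by replacing, for each $(k,k+1)\in T$, the sign $\otimes$ between $u_{\sigma(k)}$ and $u_{\sigma(k+1)}$ by multiplication in $A$. With this product $Ш_C(A)$ is a commutative ring with identity $1_A\in A$. For $k\ge 0$ let $\mathrm{Fil}^k=\bigoplus_{n\ge k}A^{\otimes(n+1)}$, which is an ideal, and let $\widehat{Ш}_C(A)=\varprojlim_k Ш_C(A)/\mathrm{Fil}^k$ be the completion. Its elements are the infinite sums $\sum_{n\ge0}a_n$ with $a_n\in A^{\otimes(n+1)}$. Write $1^{\otimes n}=1_A\otimes\cdots\otimes 1_A\in A^{\otimes n}$. Then: 1. $Ш_C(A)$ is an integral domain for every $\lambda\in C$. 2. For every $\lambda\in C$, $\widehat{Ш}_C(A)$ is an integral domain if and only if $\lambda=0$. 3. If $\lambda\ne0$, then the elements \[ x=1^{\otimes 2},\qquad y=\sum_{n=0}^\infty(-\lambda)^{-n}\,1^{\otimes(n+1)} \] of $\widehat{Ш}_C(A)$ are both nonzero and satisfy $xy=0$. -/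

import Mathlib

open scoped TensorProduct

/-- A mixable `(m, n)`-shuffle `(σ, T)`.  Positions and letters are numbered from `0`, so that the
letters `< m` are those of the first word.  The permutation `σ` is an `(m, n)`-shuffle, and `T` is
a set of admissible pairs `(k, k + 1)` of `σ`, each recorded by its first entry `k`. -/
@[ext]
structure MixableShuffle (m n : ℕ) where
  perm : Equiv.Perm (Fin (m + n))
  T : Finset (Fin (m + n))
  left_lt : ∀ i j : Fin m, i < j → perm.symm (Fin.castAdd n i) < perm.symm (Fin.castAdd n j)
  right_lt : ∀ i j : Fin n, i < j → perm.symm (Fin.natAdd m i) < perm.symm (Fin.natAdd m j)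
  admissible : ∀ k ∈ T, ∃ h : (k : ℕ) + 1 < m + n,
    (perm k : ℕ) < m ∧ m ≤ (perm ⟨(k : ℕ) + 1, h⟩ : ℕ)

namespace MixableShuffle

variable {m n : ℕ}

noncomputable instance : Fintype (MixableShuffle m n) :=
  Fintype.ofInjective (fun s => (s.perm, s.T)) (by
    intro s t h
    simp only [Prod.mk.injEq] at h
    exact MixableShuffle.ext h.1 h.2)

/-- The number of tensor factors left after the pairs in `T` have been merged. -/
abbrev len (s : MixableShuffle m n) : ℕ := m + n - s.T.card

theorem block_lt (s : MixableShuffle m n) (k : Fin (m + n)) :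
    (Finset.univ.filter fun t => t < k ∧ t ∉ s.T).card < s.len := by
  classical
  have hc : s.len = (Finset.univ.filter fun t => t ∉ s.T).card := by
    rw [← Finset.compl_filter, Finset.card_compl]
    simp [len]
  rw [hc]
  apply Finset.card_lt_card
  rw [Finset.ssubset_iff_of_subset (fun t ht => by simp at ht ⊢; exact ht.2)]
  have hpos := k.2
  refine ⟨⟨m + n - 1, by omega⟩, ?_, ?_⟩
  · simp only [Finset.mem_filter, Finset.mem_univ, true_and]
    intro h
    obtain ⟨h1, -⟩ := s.admissible _ h
    simp only at h1
    omega
  · simp only [Finset.mem_filter, Finset.mem_univ, true_and, not_and]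
    intro h
    rw [Fin.lt_def] at h
    simp only at h
    omega

/-- The tensor factor into which position `k` falls after the merging: the number of positions
`t < k` such that `(t, t + 1)` is not merged. -/
def block (s : MixableShuffle m n) (k : Fin (m + n)) : Fin s.len :=
  ⟨(Finset.univ.filter fun t => t < k ∧ t ∉ s.T).card, s.block_lt k⟩

/-- The mixable shuffle `σ(x ⊗ y; T)` of two words: its `j`-th factor is the product of the letters
`u_{σ(k)}`, where `u` is the concatenation of `x` and `y` and `k` runs over the positions that fall
into the factor `j`. -/
def word {A : Type*} [CommMonoid A] (s : MixableShuffle m n) (x : Fin m → A) (y : Fin n → A) :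
    Fin s.len → A :=
  fun j => ∏ k with s.block k = j, Fin.append x y (s.perm k)

/-- The factor that receives the `i`-th letter of the first word. -/
def left (s : MixableShuffle m n) (i : Fin m) : Fin s.len :=
  s.block (s.perm.symm (Fin.castAdd n i))

/-- The factor that receives the `i`-th letter of the second word. -/
def right (s : MixableShuffle m n) (i : Fin n) : Fin s.len :=
  s.block (s.perm.symm (Fin.natAdd m i))

theorem word_apply {A : Type*} [CommMonoid A] (s : MixableShuffle m n) (x : Fin m → A)
    (y : Fin n → A) (j : Fin s.len) :
    s.word x y j = (∏ i, if s.left i = j then x i else 1) *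
      ∏ i, if s.right i = j then y i else 1 := by
  rw [word, Finset.prod_filter, ← Equiv.prod_comp s.perm.symm, Fin.prod_univ_add]
  simp [left, right]
  rfl

theorem block_mono (s : MixableShuffle m n) : Monotone s.block := by
  intro a b hab
  rw [Fin.le_def]
  dsimp only [block]
  apply Finset.card_le_card
  intro t ht
  simp at ht ⊢
  exact ⟨ht.1.trans_le hab, ht.2⟩

theorem block_lt_of_notMem (s : MixableShuffle m n) {a b : Fin (m + n)} {t : Fin (m + n)}
    (hat : a ≤ t) (htb : t < b) (ht : t ∉ s.T) : s.block a < s.block b := by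
  rw [Fin.lt_def]
  dsimp only [block]
  apply Finset.card_lt_card
  rw [Finset.ssubset_iff_of_subset]
  · exact ⟨t, by simp [htb, ht], by simp [hat]⟩
  · intro t ht
    simp at ht ⊢
    exact ⟨ht.1.trans (hat.trans_lt htb), ht.2⟩

theorem mem_of_block_eq (s : MixableShuffle m n) {a b t : Fin (m + n)}
    (h : s.block a = s.block b) (hat : a ≤ t) (htb : t < b) : t ∈ s.T := by
  by_contra ht
  exact absurd h (s.block_lt_of_notMem hat htb ht).ne

/-- Distinct positions in one factor are an admissible pair. -/
theorem of_block_eq (s : MixableShuffle m n) {a b : Fin (m + n)}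
    (h : s.block a = s.block b) (hab : a < b) :
    a ∈ s.T ∧ (b : ℕ) = a + 1 ∧ (s.perm a : ℕ) < m ∧ m ≤ (s.perm b : ℕ) := by
  have ha := s.mem_of_block_eq h le_rfl hab
  obtain ⟨h1, h2, h3⟩ := s.admissible a ha
  rw [Fin.lt_def] at hab
  rcases Nat.lt_or_ge ((a : ℕ) + 1) b with hb | hb
  · have := s.mem_of_block_eq (t := ⟨a + 1, h1⟩) h (by rw [Fin.le_def]; simp) hb
    obtain ⟨-, h5, -⟩ := s.admissible _ this
    omega
  · have : (b : ℕ) = a + 1 := by omega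
    refine ⟨ha, this, h2, ?_⟩
    convert h3

theorem block_succ (s : MixableShuffle m n) {a b : Fin (m + n)} (ha : a ∈ s.T)
    (hb : (b : ℕ) = a + 1) : s.block a = s.block b := by
  rw [Fin.ext_iff]
  unfold block
  simp only
  congr 1
  ext t
  simp only [Finset.mem_filter, Finset.mem_univ, true_and, Fin.lt_def, hb]
  constructor
  · rintro ⟨h1, h2⟩
    exact ⟨by omega, h2⟩
  · rintro ⟨h1, h2⟩
    refine ⟨?_, h2⟩
    rcases Nat.lt_or_ge (t : ℕ) a with h | h
    · exact h
    · have : t = a := Fin.ext (by omega)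
      exact absurd (this ▸ ha) h2

theorem block_surjective (s : MixableShuffle m n) : Function.Surjective s.block := by
  classical
  have hinj : Function.Injective (fun t : {t // t ∉ s.T} => s.block t) := by
    intro a b h
    by_contra hne
    rcases lt_or_gt_of_ne hne with hl | hl
    · exact absurd h (s.block_lt_of_notMem le_rfl hl a.2).ne
    · exact absurd h (s.block_lt_of_notMem le_rfl hl b.2).ne'
  have hbij := (Fintype.bijective_iff_injective_and_card _).2 ⟨hinj, by simp [len]⟩
  intro j
  obtain ⟨t, ht⟩ := hbij.2 j
  exact ⟨t, ht⟩

theorem left_strictMono (s : MixableShuffle m n) : StrictMono s.left := by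
  intro i j hij
  have h := s.left_lt i j hij
  refine lt_of_le_of_ne (s.block_mono h.le) fun he => ?_
  obtain ⟨-, -, -, h4⟩ := s.of_block_eq he h
  simp at h4
  omega

theorem right_strictMono (s : MixableShuffle m n) : StrictMono s.right := by
  intro i j hij
  have h := s.right_lt i j hij
  refine lt_of_le_of_ne (s.block_mono h.le) fun he => ?_
  obtain ⟨-, -, h3, -⟩ := s.of_block_eq he h
  simp at h3

theorem append_left_right (s : MixableShuffle m n) (i : Fin (m + n)) :
    Fin.append s.left s.right i = s.block (s.perm.symm i) := by
  induction i using Fin.addCases <;> simp [left, right]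

theorem left_or_right (s : MixableShuffle m n) (j : Fin s.len) :
    (∃ i, s.left i = j) ∨ ∃ i, s.right i = j := by
  obtain ⟨k, hk⟩ := s.block_surjective j
  obtain ⟨i, rfl⟩ := s.perm.symm.surjective k
  induction i using Fin.addCases with
  | left i => exact Or.inl ⟨i, hk⟩
  | right i => exact Or.inr ⟨i, hk⟩

theorem card_T_le (s : MixableShuffle m n) : s.T.card ≤ m + n := by
  simpa using Finset.card_le_univ s.T

/-- The number of factors that receive two letters. -/
theorem card_both (s : MixableShuffle m n) :
    (Finset.univ.filter fun j => (∃ i, s.left i = j) ∧ ∃ i, s.right i = j).card = s.T.card := by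
  have h := Finset.card_union_add_card_inter (Finset.univ.image s.left) (Finset.univ.image s.right)
  rw [Finset.card_image_of_injective _ s.left_strictMono.injective,
    Finset.card_image_of_injective _ s.right_strictMono.injective] at h
  have h1 : Finset.univ.image s.left ∪ Finset.univ.image s.right = Finset.univ := by
    ext j
    simpa using s.left_or_right j
  have := s.card_T_le
  rw [h1] at h
  simp only [Finset.card_univ, Fintype.card_fin] at h
  trans (Finset.univ.image s.left ∩ Finset.univ.image s.right).card
  · congr 1
    ext j
    simp
  · simp only [len] at h ⊢
    omega

theorem le_len_left (s : MixableShuffle m n) : m ≤ s.len := by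
  simpa using Fintype.card_le_of_injective _ s.left_strictMono.injective

theorem le_len_right (s : MixableShuffle m n) : n ≤ s.len := by
  simpa using Fintype.card_le_of_injective _ s.right_strictMono.injective

/-- A mixable shuffle, followed by an increasing map of its factors into `Fin N`, yields two
increasing maps into `Fin N`. -/
def split (N : ℕ) (q : Σ s : MixableShuffle m n, Fin s.len ↪o Fin N) :
    (Fin m ↪o Fin N) × (Fin n ↪o Fin N) :=
  (OrderEmbedding.ofStrictMono (q.2 ∘ q.1.left) (q.2.strictMono.comp q.1.left_strictMono),
    OrderEmbedding.ofStrictMono (q.2 ∘ q.1.right) (q.2.strictMono.comp q.1.right_strictMono))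

theorem append_split (N : ℕ) (s : MixableShuffle m n) (h : Fin s.len ↪o Fin N) (k : Fin (m + n)) :
    Fin.append (h ∘ s.left) (h ∘ s.right) (s.perm k) = h (s.block k) := by
  have := s.append_left_right (s.perm k)
  rw [Equiv.symm_apply_apply] at this
  rw [← this]
  generalize s.perm k = i
  induction i using Fin.addCases <;> simp

theorem perm_eq_sort (N : ℕ) (s : MixableShuffle m n) (h : Fin s.len ↪o Fin N) :
    s.perm = Tuple.sort (Fin.append (h ∘ s.left) (h ∘ s.right)) := by
  rw [Tuple.eq_sort_iff]
  constructor
  · intro a b hab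
    simp only [Function.comp_apply, append_split]
    exact h.monotone (s.block_mono hab)
  · intro a b hab he
    rw [append_split, append_split, h.injective.eq_iff] at he
    obtain ⟨-, -, h1, h2⟩ := s.of_block_eq he hab
    rw [Fin.lt_def]
    omega

theorem split_injective (N : ℕ) : Function.Injective (split (m := m) (n := n) N) := by
  rintro ⟨s, h⟩ ⟨s', h'⟩ he
  simp only [split, Prod.mk.injEq] at he
  have hl : h ∘ s.left = h' ∘ s'.left := congrArg (fun e : Fin m ↪o Fin N => (e : Fin m → Fin N)) he.1
  have hr : h ∘ s.right = h' ∘ s'.right :=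
    congrArg (fun e : Fin n ↪o Fin N => (e : Fin n → Fin N)) he.2
  have hp : s.perm = s'.perm := by rw [perm_eq_sort N s h, perm_eq_sort N s' h', hl, hr]
  have hb : ∀ k, h (s.block k) = h' (s'.block k) := by
    intro k
    rw [← append_split, ← append_split, hl, hr, hp]
  have hT : s.T = s'.T := by
    ext k
    constructor
    · intro hk
      obtain ⟨h1, -⟩ := s.admissible k hk
      have := s.block_succ (b := ⟨k + 1, h1⟩) hk rfl
      have h2 : s'.block k = s'.block ⟨k + 1, h1⟩ := h'.injective (by rw [← hb, ← hb, this])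
      exact (s'.of_block_eq h2 (by rw [Fin.lt_def]; simp)).1
    · intro hk
      obtain ⟨h1, -⟩ := s'.admissible k hk
      have := s'.block_succ (b := ⟨k + 1, h1⟩) hk rfl
      have h2 : s.block k = s.block ⟨k + 1, h1⟩ := h.injective (by rw [hb, hb, this])
      exact (s.of_block_eq h2 (by rw [Fin.lt_def]; simp)).1
  obtain rfl : s = s' := MixableShuffle.ext hp hT
  congr 1
  ext j
  obtain ⟨k, rfl⟩ := s.block_surjective j
  rw [hb]

theorem split_surjective (N : ℕ) : Function.Surjective (split (m := m) (n := n) N) := by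
  rintro ⟨f, g⟩
  set w : Fin (m + n) → Fin N := Fin.append f g with hw
  set σ := Tuple.sort w with hσ
  obtain ⟨hmono, htie⟩ := (Tuple.eq_sort_iff (f := w) (σ := σ)).1 rfl
  have key : ∀ a b, w (σ a) < w (σ b) → a < b := by
    intro a b hab
    by_contra hba
    exact absurd (hmono (not_lt.1 hba)) (not_le.2 hab)
  have hadm : ∀ a b, a < b → w (σ a) = w (σ b) → (σ a : ℕ) < m ∧ m ≤ (σ b : ℕ) := by
    intro a b hab he
    have hlt := htie a b hab he
    revert he hlt
    generalize σ a = u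
    generalize σ b = v
    induction u using Fin.addCases with
    | left i =>
      induction v using Fin.addCases with
      | left j =>
        intro he hlt
        simp only [hw, Fin.append_left] at he
        rw [f.injective he] at hlt
        exact absurd hlt (lt_irrefl _)
      | right j => intro _ _; simp
    | right i =>
      induction v using Fin.addCases with
      | left j =>
        intro _ hlt
        rw [Fin.lt_def] at hlt
        simp at hlt
        omega
      | right j =>
        intro he hlt
        simp only [hw, Fin.append_right] at he
        rw [g.injective he] at hlt
        exact absurd hlt (lt_irrefl _)
  classical
  let s : MixableShuffle m n :=
    { perm := σ
      T := Finset.univ.filter fun k => ∃ h : (k : ℕ) + 1 < m + n, w (σ k) = w (σ ⟨k + 1, h⟩)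
      left_lt := by
        intro i j hij
        apply key
        simpa [hw] using hij
      right_lt := by
        intro i j hij
        apply key
        simpa [hw] using hij
      admissible := by
        intro k hk
        simp only [Finset.mem_filter, Finset.mem_univ, true_and] at hk
        obtain ⟨h1, h2⟩ := hk
        exact ⟨h1, hadm _ _ (by rw [Fin.lt_def]; simp) h2⟩ }
  have hbw : ∀ a b, a < b → s.block a < s.block b → w (σ a) < w (σ b) := by
    intro a b hab hlt
    refine lt_of_le_of_ne (hmono hab.le) fun he => ?_
    refine absurd hlt ?_
    obtain ⟨d, hd⟩ : ∃ d, (b : ℕ) = a + d := ⟨b - a, by rw [Fin.lt_def] at hab; omega⟩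
    have : (b : ℕ) = a + 1 := by
      by_contra hne
      rw [Fin.lt_def] at hab
      have hbl := b.2
      let c : Fin (m + n) := ⟨a + 1, by omega⟩
      have hac : a < c := by rw [Fin.lt_def]; simp [c]
      have hcb : c < b := by rw [Fin.lt_def]; simp only [c]; omega
      have e1 : w (σ a) = w (σ c) :=
        le_antisymm (hmono hac.le) ((hmono hcb.le).trans he.ge)
      have h1 := hadm a c hac e1
      have h2 := hadm c b hcb (e1.symm.trans he)
      omega
    have hbl := b.2
    have hmem : a ∈ s.T := by
      simp only [s, Finset.mem_filter, Finset.mem_univ, true_and]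
      refine ⟨by omega, he.trans ?_⟩
      congr 2
      exact Fin.ext this
    rw [s.block_succ hmem this]
    exact lt_irrefl _
  have hwb : ∀ a b, s.block a = s.block b → w (σ a) = w (σ b) := by
    have : ∀ a b, a < b → s.block a = s.block b → w (σ a) = w (σ b) := by
      intro a b hab he
      obtain ⟨hm, hb, -⟩ := s.of_block_eq he hab
      simp only [s, Finset.mem_filter, Finset.mem_univ, true_and] at hm
      obtain ⟨h1, h2⟩ := hm
      rw [h2]
      congr 2
      exact Fin.ext hb.symm
    intro a b he
    rcases lt_trichotomy a b with h | h | h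
    · exact this a b h he
    · rw [h]
    · exact (this b a h he.symm).symm
  let c := Function.surjInv s.block_surjective
  have hc : ∀ j, s.block (c j) = j := Function.surjInv_eq s.block_surjective
  have hsm : StrictMono fun j => w (σ (c j)) := by
    intro i j hij
    have hlt : s.block (c i) < s.block (c j) := by rwa [hc, hc]
    refine hbw _ _ ?_ hlt
    by_contra hle
    exact absurd (s.block_mono (not_lt.1 hle)) (not_le.2 hlt)
  refine ⟨⟨s, OrderEmbedding.ofStrictMono _ hsm⟩, ?_⟩
  simp only [split, Prod.mk.injEq]
  constructor
  · ext i
    simp only [OrderEmbedding.coe_ofStrictMono, Function.comp_apply, left]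
    rw [hwb _ _ (hc _)]
    simp [s, hw]
  · ext i
    simp only [OrderEmbedding.coe_ofStrictMono, Function.comp_apply, right]
    rw [hwb _ _ (hc _)]
    simp [s, hw]

end MixableShuffle

universe u v

/-- The tensor power `A^{⊗ n}` over `C`. -/
abbrev TPow (C : Type u) (A : Type v) [CommRing C] [CommRing A] [Algebra C A] (n : ℕ) :
    Type (max u v) :=
  PiTensorProduct C fun _ : Fin n => A

namespace TPow

variable {C : Type u} {A : Type v} [CommRing C] [CommRing A] [Algebra C A]
variable {B : Type v} [CommRing B] [Algebra C B]

/-- The linear map `A^{⊗ m} → B^{⊗ k}` that sends `a_0 ⊗ ⋯ ⊗ a_{m-1}` to the tensor whose `j`-th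
factor is the product of the `φ_i (a_i)` over all `i` with `p i = j`. -/
noncomputable def merge {m k : ℕ} (φ : Fin m → A →ₗ[C] B) (p : Fin m → Fin k) :
    TPow C A m →ₗ[C] TPow C B k :=
  PiTensorProduct.lift ((MultilinearMap.mkPiAlgebra C (Fin m) (TPow C B k)).compLinearMap
    fun i => (PiTensorProduct.singleAlgHom (R := C) (A := fun _ : Fin k => B) (p i)).toLinearMap ∘ₗ
      φ i)

theorem merge_tprod {m k : ℕ} (φ : Fin m → A →ₗ[C] B) (p : Fin m → Fin k) (a : Fin m → A) :
    merge φ p (PiTensorProduct.tprod C a) =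
      PiTensorProduct.tprod C fun j => ∏ i, if p i = j then φ i (a i) else 1 := by
  simp only [merge, PiTensorProduct.lift.tprod, MultilinearMap.compLinearMap_apply,
    MultilinearMap.mkPiAlgebra_apply, LinearMap.comp_apply, AlgHom.toLinearMap_apply,
    PiTensorProduct.singleAlgHom_apply]
  rw [← PiTensorProduct.tprod_prod]
  congr 1
  ext j
  rw [Finset.prod_apply]
  refine Finset.prod_congr rfl fun i _ => ?_
  simp only [MonoidHom.mulSingle_apply, Pi.mulSingle_apply, eq_comm]

end TPow

/-- Extends a map of positions by the position `0` of the leading factor. -/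
def liftPos {m k : ℕ} (f : Fin m → Fin k) : Fin (m + 1) → Fin (k + 1) :=
  Fin.cons 0 fun i => (f i).succ

namespace MixableShuffle

variable {C : Type u} {A : Type v} [CommRing C] [CommRing A] [Algebra C A] {m n : ℕ}

/-- The bilinear map `(x, y) ↦ x_0 y_0 ⊗ σ(x⁺ ⊗ y⁺; T)` on tensors; see `prodTerm_tprod`. -/
noncomputable def prodTerm (s : MixableShuffle m n) :
    TPow C A (m + 1) →ₗ[C] TPow C A (n + 1) →ₗ[C] TPow C A (s.len + 1) :=
  (LinearMap.mul C (TPow C A (s.len + 1))).compl₁₂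
    (TPow.merge (fun _ => LinearMap.id) (liftPos s.left))
    (TPow.merge (fun _ => LinearMap.id) (liftPos s.right))

/-- The formula `x_0 y_0 ⊗ σ(x⁺ ⊗ y⁺; T)` on pure tensors, which determines `prodTerm`. -/
theorem prodTerm_tprod (s : MixableShuffle m n) (x : Fin (m + 1) → A) (y : Fin (n + 1) → A) :
    s.prodTerm (PiTensorProduct.tprod C x) (PiTensorProduct.tprod C y) =
      PiTensorProduct.tprod C
        (Fin.cons (x 0 * y 0) (s.word (Fin.tail x) (Fin.tail y)) : Fin (s.len + 1) → A) := by
  simp only [prodTerm, LinearMap.compl₁₂_apply, TPow.merge_tprod, LinearMap.mul_apply',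
    PiTensorProduct.tprod_mul_tprod]
  congr 1
  ext j
  induction j using Fin.cases with
  | zero => simp [Fin.prod_univ_succ, liftPos]
  | succ j =>
    simp [Fin.prod_univ_succ, liftPos, word_apply, Fin.tail, (Fin.succ_ne_zero j).symm]

end MixableShuffle

/-- The module underlying the shuffle Baxter algebra `Ш_C(A)` of weight `lam`: the direct sum of
the tensor powers `A^{⊗ (k + 1)}`, `k ≥ 0`.  It carries the mixed shuffle product of weight
`lam`, which is the only place where the weight enters. -/
def Sha (C : Type u) (A : Type v) [CommRing C] [CommRing A] [Algebra C A] (_lam : C) :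
    Type (max u v) :=
  DirectSum ℕ fun k => TPow C A (k + 1)

namespace Sha

variable {C : Type u} {A : Type v} [CommRing C] [CommRing A] [Algebra C A] {lam : C}

noncomputable instance : AddCommGroup (Sha C A lam) :=
  inferInstanceAs (AddCommGroup (DirectSum ℕ fun k => TPow C A (k + 1)))

noncomputable instance : Module C (Sha C A lam) :=
  inferInstanceAs (Module C (DirectSum ℕ fun k => TPow C A (k + 1)))

variable (C A lam) in
/-- The inclusion of the summand `A^{⊗ (k + 1)}`. -/
noncomputable def of (k : ℕ) : TPow C A (k + 1) →ₗ[C] Sha C A lam :=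
  DirectSum.lof C ℕ (fun k => TPow C A (k + 1)) k

variable (C A lam) in
/-- The component in `A^{⊗ (k + 1)}`. -/
noncomputable def coeff (k : ℕ) : Sha C A lam →ₗ[C] TPow C A (k + 1) :=
  DirectSum.component C ℕ (fun k => TPow C A (k + 1)) k

theorem coeff_of_self (k : ℕ) (x : TPow C A (k + 1)) :
    coeff C A lam k (of C A lam k x) = x :=
  DirectSum.component.lof_self _ _ _

theorem coeff_of_ne {j k : ℕ} (h : j ≠ k) (x : TPow C A (k + 1)) :
    coeff C A lam j (of C A lam k x) = 0 := by
  exact (DirectSum.component.of C (M := fun k => TPow C A (k + 1)) j k x).trans (dif_neg h.symm)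

theorem ext_coeff {x y : Sha C A lam} (h : ∀ k, coeff C A lam k x = coeff C A lam k y) : x = y :=
  DirectSum.ext_component C h

theorem linearMap_ext {M : Type*} [AddCommGroup M] [Module C M] {f g : Sha C A lam →ₗ[C] M}
    (h : ∀ (k : ℕ) (a : Fin (k + 1) → A), f (of C A lam k (PiTensorProduct.tprod C a)) =
      g (of C A lam k (PiTensorProduct.tprod C a))) : f = g := by
  refine DirectSum.linearMap_ext C fun k => PiTensorProduct.ext ?_
  ext a
  exact h k a

/-- The linear map on `Ш_C(A)` with prescribed restrictions to the summands. -/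
noncomputable def lift {M : Type*} [AddCommGroup M] [Module C M]
    (φ : ∀ k, TPow C A (k + 1) →ₗ[C] M) : Sha C A lam →ₗ[C] M :=
  DirectSum.toModule C ℕ M φ

theorem lift_of {M : Type*} [AddCommGroup M] [Module C M]
    (φ : ∀ k, TPow C A (k + 1) →ₗ[C] M) (k : ℕ) (x : TPow C A (k + 1)) :
    lift φ (of C A lam k x) = φ k x :=
  DirectSum.toModule_lof C (ι := ℕ) (M := fun k => TPow C A (k + 1)) k x

variable (C A lam) in
/-- The mixed shuffle product of weight `lam` as a bilinear map: on `A^{⊗ (m + 1)}` and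
`A^{⊗ (n + 1)}` it is the sum over all mixable `(m, n)`-shuffles `(σ, T)` of
`lam ^ |T|` times `x_0 y_0 ⊗ σ(x⁺ ⊗ y⁺; T)`. -/
noncomputable def mulMap : Sha C A lam →ₗ[C] Sha C A lam →ₗ[C] Sha C A lam :=
  lift fun m => LinearMap.flip <| lift fun n =>
    LinearMap.flip <| ∑ s : MixableShuffle m n,
      lam ^ s.T.card • s.prodTerm.compr₂ (of C A lam s.len)

noncomputable instance : Mul (Sha C A lam) := ⟨fun x y => mulMap C A lam x y⟩

theorem mul_def (x y : Sha C A lam) : x * y = mulMap C A lam x y := rfl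

theorem of_mul_of (m n : ℕ) (x : TPow C A (m + 1)) (y : TPow C A (n + 1)) :
    of C A lam m x * of C A lam n y =
      ∑ s : MixableShuffle m n, lam ^ s.T.card • of C A lam s.len (s.prodTerm x y) := by
  rw [mul_def, mulMap, lift_of, LinearMap.flip_apply, lift_of]
  simp [LinearMap.sum_apply]

/-- The mixed shuffle product of two pure tensors. -/
theorem tprod_mul_tprod (m n : ℕ) (x : Fin (m + 1) → A) (y : Fin (n + 1) → A) :
    of C A lam m (PiTensorProduct.tprod C x) * of C A lam n (PiTensorProduct.tprod C y) =
      ∑ s : MixableShuffle m n, lam ^ s.T.card • of C A lam s.len (PiTensorProduct.tprod C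
        (Fin.cons (x 0 * y 0) (s.word (Fin.tail x) (Fin.tail y)) : Fin (s.len + 1) → A)) := by
  simp only [of_mul_of, MixableShuffle.prodTerm_tprod]

noncomputable instance : One (Sha C A lam) := ⟨of C A lam 0 (PiTensorProduct.tprod C fun _ => 1)⟩

theorem one_def : (1 : Sha C A lam) = of C A lam 0 (PiTensorProduct.tprod C fun _ => 1) := rfl

/-! The ring axioms are checked by embedding `Ш_C(A)` into a product of tensor algebras. -/

section Embedding

variable (lam)

/-- `A ⊕ A ω` with `ω * ω = lam ω`. -/
abbrev QExt : Type v := QuadraticAlgebra A 0 (algebraMap C A lam)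

/-- `a ↦ a ω` -/
def iotaMap : A →ₗ[C] QExt (A := A) lam where
  toFun a := ⟨0, a⟩
  map_add' a b := by ext <;> simp
  map_smul' c a := by ext <;> simp

/-- `a ω + b ↦ a` -/
def imMap : QExt (A := A) lam →ₗ[C] A where
  toFun a := a.im
  map_add' a b := by simp
  map_smul' c a := by simp

/-- `a ω + b ↦ b` -/
def reMap : QExt (A := A) lam →ₗ[C] A where
  toFun a := a.re
  map_add' a b := by simp
  map_smul' c a := by simp

/-- `a ↦ a` -/
def inclMap : A →ₗ[C] QExt (A := A) lam where
  toFun a := ⟨a, 0⟩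
  map_add' a b := by ext <;> simp
  map_smul' c a := by ext <;> simp

theorem iotaMap_mul (a b : A) :
    iotaMap lam a * iotaMap lam b = lam • iotaMap (C := C) lam (a * b) := by
  ext
  · simp [iotaMap]
  · simp [iotaMap, ← Algebra.smul_def]

theorem inclMap_mul (a b : A) :
    inclMap lam a * inclMap lam b = inclMap (C := C) lam (a * b) := by
  ext <;> simp [inclMap]

/-- `a_0 ⊗ a_1 ⊗ ⋯ ↦ a_0 ⊗ a_1 ω ⊗ ⋯` with the factors placed according to `f`. -/
noncomputable def place {m N : ℕ} (f : Fin m → Fin N) :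
    TPow C A (m + 1) →ₗ[C] TPow C (QExt (A := A) lam) (N + 1) :=
  TPow.merge (Fin.cons (inclMap lam) fun _ => iotaMap lam) (liftPos f)

/-- The tensor `place f (a)`, factor by factor. -/
noncomputable def placeWord {m N : ℕ} (f : Fin m → Fin N) (a : Fin (m + 1) → A) :
    Fin (N + 1) → QExt (A := A) lam :=
  Fin.cons (inclMap lam (a 0)) fun j => ∏ i, if f i = j then iotaMap lam (a i.succ) else 1

theorem place_tprod {m N : ℕ} (f : Fin m → Fin N) (a : Fin (m + 1) → A) :
    place lam f (PiTensorProduct.tprod C a) = PiTensorProduct.tprod C (placeWord lam f a) := by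
  rw [place, TPow.merge_tprod]
  congr 1
  ext1 j
  induction j using Fin.cases with
  | zero => simp [Fin.prod_univ_succ, liftPos, placeWord]
  | succ j => simp [Fin.prod_univ_succ, liftPos, placeWord, (Fin.succ_ne_zero j).symm]

theorem prod_ite_of_injective {ι κ M : Type*} [Fintype ι] [DecidableEq κ] [CommMonoid M]
    {f : ι → κ} (hf : Function.Injective f) (v : ι → M) (i : ι) :
    (∏ l, if f l = f i then v l else 1) = v i := by
  classical
  rw [Finset.prod_eq_single i] <;> simp +contextual [hf.eq_iff]

theorem prod_ite_of_notMem {ι κ M : Type*} [Fintype ι] [DecidableEq κ] [CommMonoid M]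
    {f : ι → κ} (v : ι → M) (j : κ) (hj : ∀ i, f i ≠ j) :
    (∏ l, if f l = j then v l else 1) = 1 :=
  Finset.prod_eq_one fun l _ => if_neg (hj l)

theorem placeWord_mul {m n N : ℕ} (s : MixableShuffle m n) (h : Fin s.len ↪o Fin N)
    (x : Fin (m + 1) → A) (y : Fin (n + 1) → A) (j : Fin N) :
    placeWord lam (h ∘ s.left) x j.succ * placeWord lam (h ∘ s.right) y j.succ =
      (if ∃ l, h l = j ∧ (∃ i, s.left i = l) ∧ ∃ i, s.right i = l then lam else 1) •
        placeWord (C := C) lam h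
          (Fin.cons (x 0 * y 0) (s.word (Fin.tail x) (Fin.tail y)) : Fin (s.len + 1) → A)
          j.succ := by
  simp only [placeWord, Fin.cons_succ, Function.comp_apply]
  by_cases hj : ∃ l, h l = j
  · obtain ⟨l, rfl⟩ := hj
    simp only [h.injective.eq_iff]
    rw [prod_ite_of_injective (f := fun l => l) (fun _ _ h => h)]
    simp only [exists_eq_left, MixableShuffle.word_apply]
    have hl := s.left_strictMono.injective
    have hr := s.right_strictMono.injective
    by_cases h1 : ∃ i, s.left i = l
    · by_cases h2 : ∃ i, s.right i = l
      · rw [if_pos ⟨h1, h2⟩]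
        obtain ⟨i, rfl⟩ := h1
        obtain ⟨i', hi'⟩ := h2
        rw [prod_ite_of_injective hl, prod_ite_of_injective hl, ← hi',
          prod_ite_of_injective hr, prod_ite_of_injective hr, iotaMap_mul]
        rfl
      · rw [if_neg fun h => h2 h.2]
        obtain ⟨i, rfl⟩ := h1
        push Not at h2
        rw [prod_ite_of_injective hl, prod_ite_of_injective hl, prod_ite_of_notMem _ _ h2,
          prod_ite_of_notMem _ _ h2, one_smul, mul_one, mul_one]
        rfl
    · rw [if_neg fun h => h1 h.1]
      obtain ⟨i, rfl⟩ := (s.left_or_right l).resolve_left h1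
      push Not at h1
      rw [prod_ite_of_injective hr, prod_ite_of_injective hr, prod_ite_of_notMem _ _ h1,
          prod_ite_of_notMem _ _ h1, one_smul, one_mul, one_mul]
      rfl
  · rw [if_neg fun ⟨l, hl, _⟩ => hj ⟨l, hl⟩]
    push Not at hj
    rw [prod_ite_of_notMem _ _ hj, prod_ite_of_notMem _ _ fun i => hj (s.left i),
      prod_ite_of_notMem _ _ fun i => hj (s.right i), one_smul, one_mul]

theorem place_mul {m n N : ℕ} (s : MixableShuffle m n) (h : Fin s.len ↪o Fin N)
    (x : Fin (m + 1) → A) (y : Fin (n + 1) → A) :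
    place lam (h ∘ s.left) (PiTensorProduct.tprod C x) *
        place lam (h ∘ s.right) (PiTensorProduct.tprod C y) =
      lam ^ s.T.card • place lam h (PiTensorProduct.tprod C
        (Fin.cons (x 0 * y 0) (s.word (Fin.tail x) (Fin.tail y)) : Fin (s.len + 1) → A)) := by
  classical
  rw [place_tprod, place_tprod, place_tprod, PiTensorProduct.tprod_mul_tprod]
  let c : Fin (N + 1) → C := Fin.cons 1 fun j =>
    if ∃ l, h l = j ∧ (∃ i, s.left i = l) ∧ ∃ i, s.right i = l then lam else 1
  have hc : ∏ j, c j = lam ^ s.T.card := by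
    rw [Fin.prod_univ_succ]
    simp only [c, Fin.cons_zero, Fin.cons_succ, one_mul]
    rw [Finset.prod_ite, Finset.prod_const_one, mul_one, Finset.prod_const, ← s.card_both,
      ← Finset.card_map h.toEmbedding]
    congr 2
    ext j
    simp only [Finset.mem_filter, Finset.mem_univ, true_and, Finset.mem_map]
    constructor
    · rintro ⟨l, h1, h2⟩
      exact ⟨l, h2, h1⟩
    · rintro ⟨l, h2, h1⟩
      exact ⟨l, h1, h2⟩
  rw [← hc, ← MultilinearMap.map_smul_univ]
  congr 1
  ext1 j
  induction j using Fin.cases with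
  | zero => simp [c, placeWord, inclMap_mul]
  | succ j =>
    rw [Pi.mul_apply, placeWord_mul]
    rfl

/-- The `N`-th component of the embedding. -/
noncomputable def embed (N : ℕ) : Sha C A lam →ₗ[C] TPow C (QExt (A := A) lam) (N + 1) :=
  lift fun m => ∑ f : Fin m ↪o Fin N, place lam f

theorem embed_of (N m : ℕ) (x : TPow C A (m + 1)) :
    embed lam N (of C A lam m x) = ∑ f : Fin m ↪o Fin N, place lam f x := by
  rw [embed, lift_of, LinearMap.sum_apply]

theorem embed_mul (N : ℕ) (x y : Sha C A lam) :
    embed lam N (x * y) = embed lam N x * embed lam N y := by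
  have key : (mulMap C A lam).compr₂ (embed lam N) =
      (LinearMap.mul C _).compl₁₂ (embed lam N) (embed lam N) := by
    refine linearMap_ext fun m a => linearMap_ext fun n b => ?_
    change embed lam N (of C A lam m (PiTensorProduct.tprod C a) *
      of C A lam n (PiTensorProduct.tprod C b)) = embed lam N _ * embed lam N _
    simp only [tprod_mul_tprod, map_sum, map_smul, embed_of]
    rw [Finset.sum_mul_sum, ← Fintype.sum_prod_type',
      ← (Function.Bijective.sum_comp
        ⟨MixableShuffle.split_injective (m := m) (n := n) N, MixableShuffle.split_surjective N⟩ _),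
      Fintype.sum_sigma]
    refine Finset.sum_congr rfl fun s _ => ?_
    rw [Finset.smul_sum]
    refine Finset.sum_congr rfl fun h _ => ?_
    exact (place_mul lam s h a b).symm
  exact DFunLike.congr_fun (DFunLike.congr_fun key x) y

theorem orderEmbedding_eq {m N : ℕ} (h : N ≤ m ∨ m = 0) (f g : Fin m ↪o Fin N) : f = g := by
  rcases h with h | rfl
  · have hN : m = N := le_antisymm (by simpa using Fintype.card_le_of_embedding f.toEmbedding) h
    subst hN
    have hf : Function.Surjective f := Finite.injective_iff_surjective.1 f.injective
    have hg : Function.Surjective g := Finite.injective_iff_surjective.1 g.injective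
    exact DFunLike.coe_injective
      ((f.strictMono.range_inj g.strictMono).1 (hf.range_eq.trans hg.range_eq.symm))
  · ext i
    exact i.elim0

theorem embed_one (N : ℕ) : embed lam N (1 : Sha C A lam) = 1 := by
  have : Subsingleton (Fin 0 ↪o Fin N) := ⟨orderEmbedding_eq (Or.inr rfl)⟩
  rw [one_def, embed_of, Fintype.sum_subsingleton _ (OrderEmbedding.ofIsEmpty), place_tprod,
    PiTensorProduct.one_def]
  congr 1
  ext1 j
  induction j using Fin.cases with
  | zero => rfl
  | succ j => simp [placeWord]

/-- Recovers a component of an element of `Ш_C(A)` from the embedding. -/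
noncomputable def proj (N : ℕ) : TPow C (QExt (A := A) lam) (N + 1) →ₗ[C] TPow C A (N + 1) :=
  PiTensorProduct.map (Fin.cons (reMap lam) fun _ => imMap lam)

theorem proj_embed (N : ℕ) : proj lam N ∘ₗ embed lam N = coeff C A lam N := by
  refine linearMap_ext fun m a => ?_
  rw [LinearMap.comp_apply, embed_of, map_sum]
  simp only [place_tprod, proj, PiTensorProduct.map_tprod]
  have hzero : ∀ f : Fin m ↪o Fin N, ∀ j : Fin N, (∀ i, f i ≠ j) →
      (PiTensorProduct.tprod C fun i => (Fin.cons (reMap lam) fun _ => imMap lam :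
        Fin (N + 1) → (QExt (A := A) lam →ₗ[C] A)) i (placeWord lam f a i)) = 0 := by
    intro f j hj
    refine MultilinearMap.map_coord_zero _ j.succ ?_
    simp only [Fin.cons_succ, placeWord]
    rw [prod_ite_of_notMem _ _ hj]
    rfl
  by_cases hm : m = N
  · subst hm
    have : Subsingleton (Fin m ↪o Fin m) := ⟨orderEmbedding_eq (Or.inl le_rfl)⟩
    rw [coeff_of_self, Fintype.sum_subsingleton _ (OrderIso.refl (Fin m)).toOrderEmbedding]
    congr 1
    ext1 j
    induction j using Fin.cases with
    | zero => rfl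
    | succ j =>
      exact congrArg (imMap lam) (prod_ite_of_injective (f := fun l : Fin m => l)
        Function.injective_id (fun i => iotaMap lam (a i.succ)) j)
  · rw [coeff_of_ne (Ne.symm hm)]
    refine Finset.sum_eq_zero fun f _ => ?_
    have : ¬ Function.Surjective f := fun hs => hm <| by
      simpa using Fintype.card_of_bijective ⟨f.injective, hs⟩
    simp only [Function.Surjective, not_forall, not_exists] at this
    obtain ⟨j, hj⟩ := this
    exact hzero f j hj

theorem embed_injective : Function.Injective
    fun (x : Sha C A lam) (N : ℕ) => embed lam N x := by
  intro x y h
  refine ext_coeff fun N => ?_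
  rw [← proj_embed, LinearMap.comp_apply, LinearMap.comp_apply]
  exact congrArg _ (congrFun h N)

end Embedding

/-- The shuffle Baxter algebra as a commutative ring under the mixed shuffle product. -/
noncomputable instance : CommRing (Sha C A lam) where
  __ := (inferInstance : AddCommGroup (Sha C A lam))
  left_distrib x y z := map_add (mulMap C A lam x) y z
  right_distrib x y z := by simp only [mul_def, map_add, LinearMap.add_apply]
  zero_mul x := by simp only [mul_def, map_zero, LinearMap.zero_apply]
  mul_zero x := map_zero (mulMap C A lam x)
  mul_assoc x y z := embed_injective lam <| funext fun N => by simp only [embed_mul, mul_assoc]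
  one_mul x := embed_injective lam <| funext fun N => by simp only [embed_mul, embed_one, one_mul]
  mul_one x := embed_injective lam <| funext fun N => by simp only [embed_mul, embed_one, mul_one]
  mul_comm x y := embed_injective lam <| funext fun N => by simp only [embed_mul, mul_comm]

theorem exists_eq_sum (x : Sha C A lam) :
    ∃ S : Finset ℕ, x = ∑ n ∈ S, of C A lam n (coeff C A lam n x) := by
  classical
  exact ⟨DFinsupp.support x, (DirectSum.sum_support_of x).symm⟩

theorem coeff_mul_of_of_lt {n p : ℕ} (h : n < p) (x : Sha C A lam) (y : TPow C A (p + 1)) :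
    coeff C A lam n (x * of C A lam p y) = 0 := by
  obtain ⟨S, hS⟩ := exists_eq_sum x
  rw [hS, Finset.sum_mul, map_sum]
  refine Finset.sum_eq_zero fun m _ => ?_
  rw [of_mul_of, map_sum]
  refine Finset.sum_eq_zero fun s _ => ?_
  rw [map_smul, coeff_of_ne (h.trans_le s.le_len_right).ne, smul_zero]

variable (C A lam) in
/-- The ideal `Fil^k Ш_C(A)`, the sum of the `A^{⊗ (n + 1)}` with `n ≥ k`. -/
noncomputable def fil (k : ℕ) : Ideal (Sha C A lam) where
  carrier := {x | ∀ n < k, coeff C A lam n x = 0}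
  add_mem' hx hy n hn := by rw [map_add, hx n hn, hy n hn, add_zero]
  zero_mem' n _ := map_zero _
  smul_mem' c x hx n hn := by
    obtain ⟨S, hS⟩ := exists_eq_sum x
    rw [hS, smul_eq_mul, Finset.mul_sum, map_sum]
    refine Finset.sum_eq_zero fun p _ => ?_
    rcases lt_or_ge p k with hp | hp
    · rw [hx p hp, map_zero, mul_zero, map_zero]
    · exact coeff_mul_of_of_lt (hn.trans_le hp) c _

theorem fil_anti {j k : ℕ} (h : j ≤ k) : fil C A lam k ≤ fil C A lam j :=
  fun _ hx n hn => hx n (hn.trans_le h)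

end Sha

/-- The complete shuffle Baxter algebra, i.e. the inverse limit of the rings
`Ш_C(A) / Fil^k Ш_C(A)`, realized as the ring of compatible families.  (The index `k = 0` only
contributes the zero ring.) -/
def shaHatSubring (C : Type u) (A : Type v) [CommRing C] [CommRing A] [Algebra C A] (lam : C) :
    Subring (∀ k : ℕ, Sha C A lam ⧸ Sha.fil C A lam k) where
  carrier := {x | ∀ (j k : ℕ) (h : j ≤ k), Ideal.Quotient.factor (Sha.fil_anti h) (x k) = x j}
  mul_mem' hx hy j k h := by rw [Pi.mul_apply, map_mul, hx j k h, hy j k h, Pi.mul_apply]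
  one_mem' j k h := by rw [Pi.one_apply, map_one, Pi.one_apply]
  add_mem' hx hy j k h := by rw [Pi.add_apply, map_add, hx j k h, hy j k h, Pi.add_apply]
  zero_mem' j k h := by rw [Pi.zero_apply, map_zero, Pi.zero_apply]
  neg_mem' hx j k h := by rw [Pi.neg_apply, map_neg, hx j k h, Pi.neg_apply]

/-- The completion `Ш̂_C(A)` of the shuffle Baxter algebra of weight `lam`. -/
abbrev ShaHat (C : Type u) (A : Type v) [CommRing C] [CommRing A] [Algebra C A] (lam : C) :
    Type (max u v) :=
  shaHatSubring C A lam

namespace ShaHat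

variable {C : Type u} {A : Type v} [CommRing C] [CommRing A] [Algebra C A] {lam : C}

/-- The infinite sum `∑_n a_n`, `a_n ∈ A^{⊗ (n + 1)}`, in `Ш̂_C(A)`: its residue modulo `Fil^k` is
that of `∑_{n < k} a_n`. -/
noncomputable def series (lam : C) (a : ∀ n : ℕ, TPow C A (n + 1)) : ShaHat C A lam :=
  ⟨fun k => Ideal.Quotient.mk _ (∑ n ∈ Finset.range k, Sha.of C A lam n (a n)), by
    intro j k h
    rw [Ideal.Quotient.factor_mk, Ideal.Quotient.eq, ← Finset.sum_range_add_sum_Ico _ h,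
      add_sub_cancel_left]
    refine sum_mem fun n hn i hi => Sha.coeff_of_ne ?_ _
    exact (hi.trans_le (Finset.mem_Ico.1 hn).1).ne⟩

variable (C A lam) in
/-- The canonical map `Ш_C(A) → Ш̂_C(A)`. -/
noncomputable def ofSha : Sha C A lam →+* ShaHat C A lam :=
  (RingHom.pi fun k => Ideal.Quotient.mk (Sha.fil C A lam k)).codRestrict (shaHatSubring C A lam)
    fun _ _ _ _ => rfl

end ShaHat

/-- The element `1^{⊗ n}` of `A^{⊗ n}`. -/
noncomputable def onePow (C : Type u) (A : Type v) [CommRing C] [CommRing A] [Algebra C A]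
    (n : ℕ) : TPow C A n :=
  PiTensorProduct.tprod C fun _ => 1

/-! A shuffle of degrees m and n in which nothing is merged lands in degree m + n. Each merged pair
lowers the degree by one and costs a factor `lam`. The component of a product in degree m + n is
therefore the ordinary shuffle product, whatever the weight, and everything rests on this product
having no zero divisors (`Sha.coeff_add_of_mul_of_ne_zero`). To see this, fix an ordered C-basis of
A and expand tensors as A-combinations of words in it, with the leading factor serving as scalar.
Interleaving words along a fixed shuffle is strictly increasing in the lexicographic order, so the
largest shuffle of the two leading words arises from no other pair of words. Its coefficient is a
positive integer times the product of the leading coefficients, which is nonzero because A is a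
domain of characteristic zero.

For `Sha`, apply this to the top components of two elements. In weight zero the product is graded,
so the same works for the lowest components. Hence elements outside Fil^j and Fil^k have product
outside Fil^(j+k), and this bound passes to the completion.

For nonzero weight, 1^{⊗2} · 1^{⊗(n+1)} = (n+1) 1^{⊗(n+2)} + n λ 1^{⊗(n+1)}. The coefficients
(-λ)^{-n} make the sum of these products telescope to zero, so the completion has zero divisors. -/

namespace MixableShuffle

/-! ### Shuffles without merged pairs -/

variable {m n : ℕ}

theorem block_injective_of_T_eq_empty (s : MixableShuffle m n) (hs : s.T = ∅) :
    Function.Injective s.block := by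
  intro a b h
  by_contra hne
  rcases lt_or_gt_of_ne hne with hl | hl
  · simpa [hs] using (s.of_block_eq h hl).1
  · simpa [hs] using (s.of_block_eq h.symm hl).1

theorem len_of_T_eq_empty (s : MixableShuffle m n) (hs : s.T = ∅) : s.len = m + n := by
  simp [len, hs]

theorem block_of_T_eq_empty (s : MixableShuffle m n) (hs : s.T = ∅) (k : Fin (m + n)) :
    s.block k = Fin.cast (s.len_of_T_eq_empty hs).symm k := by
  have : (Finset.univ.filter fun t => t < k ∧ t ∉ s.T) = Finset.Iio k := by
    ext t
    simp [hs]
  rw [Fin.ext_iff, block]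
  simp [this]

theorem len_lt_of_T_ne_empty (s : MixableShuffle m n) (hs : s.T ≠ ∅) : s.len < m + n := by
  have h1 := s.card_T_le
  have h2 := Finset.card_pos.2 (Finset.nonempty_iff_ne_empty.2 hs)
  simp only [len]
  omega

theorem len_le (s : MixableShuffle m n) : s.len ≤ m + n := Nat.sub_le _ _

/-- The `(m, n)`-shuffle that is the concatenation of the two words. -/
def concat (m n : ℕ) : MixableShuffle m n where
  perm := Equiv.refl _
  T := ∅
  left_lt _ _ h := h
  right_lt i j h := by simpa using h
  admissible k hk := by simp at hk

/-! ### Interleaving and the lexicographic order -/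

section Lex

variable {I : Type*}

/-- Letters of the shuffle of two words, read without merging. -/
def interleave (s : MixableShuffle m n) (u : Fin m → I) (v : Fin n → I) : Fin (m + n) → I :=
  Fin.append u v ∘ s.perm

theorem interleave_left (s : MixableShuffle m n) (u : Fin m → I) (v : Fin n → I) (i : Fin m) :
    s.interleave u v (s.perm.symm (Fin.castAdd n i)) = u i := by
  simp [interleave]

theorem interleave_right (s : MixableShuffle m n) (u : Fin m → I) (v : Fin n → I) (i : Fin n) :
    s.interleave u v (s.perm.symm (Fin.natAdd m i)) = v i := by
  simp [interleave]

/-- The coefficient of w in a shuffle product involves these two subwords of w; this identity lets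
the order lemmas be applied to them. -/
theorem interleave_restrict (s : MixableShuffle m n) (w : Fin (m + n) → I) :
    s.interleave (fun i => w (s.perm.symm (Fin.castAdd n i)))
      (fun i => w (s.perm.symm (Fin.natAdd m i))) = w := by
  ext k
  obtain ⟨i, rfl⟩ := s.perm.symm.surjective k
  induction i using Fin.addCases <;> simp [interleave]

variable [LinearOrder I]

/-- A shuffle keeps the letters of each word in order, so the first difference between the two
interleavings sits where the first differing letter of u and u' is placed. -/
theorem interleave_lt_left (s : MixableShuffle m n) {u u' : Fin m → I} (v : Fin n → I)
    (h : toLex u < toLex u') : toLex (s.interleave u v) < toLex (s.interleave u' v) := by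
  obtain ⟨i, hi, hlt⟩ := h
  refine ⟨s.perm.symm (Fin.castAdd n i), fun k hk => ?_, ?_⟩
  · obtain ⟨p, rfl⟩ := s.perm.symm.surjective k
    induction p using Fin.addCases with
    | left j =>
      have hj : j < i := by
        by_contra hji
        rcases (not_lt.1 hji).eq_or_lt with rfl | hji
        · exact lt_irrefl _ hk
        · exact lt_asymm hk (s.left_lt i j hji)
      simpa [interleave_left] using hi j hj
    | right j => simp [interleave_right]
  · simpa [interleave_left] using hlt

theorem interleave_lt_right (s : MixableShuffle m n) (u : Fin m → I) {v v' : Fin n → I}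
    (h : toLex v < toLex v') : toLex (s.interleave u v) < toLex (s.interleave u v') := by
  obtain ⟨i, hi, hlt⟩ := h
  refine ⟨s.perm.symm (Fin.natAdd m i), fun k hk => ?_, ?_⟩
  · obtain ⟨p, rfl⟩ := s.perm.symm.surjective k
    induction p using Fin.addCases with
    | left j => simp [interleave_left]
    | right j =>
      have hj : j < i := by
        by_contra hji
        rcases (not_lt.1 hji).eq_or_lt with rfl | hji
        · exact lt_irrefl _ hk
        · exact lt_asymm hk (s.right_lt i j hji)
      simpa [interleave_right] using hi j hj
  · simpa [interleave_right] using hlt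

theorem interleave_mono (s : MixableShuffle m n) {u u' : Fin m → I} {v v' : Fin n → I}
    (hu : toLex u ≤ toLex u') (hv : toLex v ≤ toLex v') :
    toLex (s.interleave u v) ≤ toLex (s.interleave u' v') := by
  trans toLex (s.interleave u' v)
  · rcases hu.eq_or_lt with h | h
    · rw [toLex.injective h]
    · exact (s.interleave_lt_left v h).le
  · rcases hv.eq_or_lt with h | h
    · rw [toLex.injective h]
    · exact (s.interleave_lt_right u' h).le

/-- Strict monotonicity in each argument leaves no room for a strict inequality. This is what
isolates the leading words. -/
theorem eq_of_interleave_le (s : MixableShuffle m n) {u u' : Fin m → I} {v v' : Fin n → I}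
    (hu : toLex u ≤ toLex u') (hv : toLex v ≤ toLex v')
    (h : toLex (s.interleave u' v') ≤ toLex (s.interleave u v)) : u = u' ∧ v = v' := by
  have hu' : u = u' := by
    by_contra hne
    exact absurd ((s.interleave_lt_left v (lt_of_le_of_ne hu hne)).trans_le
      (s.interleave_mono le_rfl hv)) (not_lt.2 h)
  subst hu'
  refine ⟨rfl, ?_⟩
  by_contra hne
  exact absurd (s.interleave_lt_right u (lt_of_le_of_ne hv hne)) (not_lt.2 h)

end Lex

/-! ### Counting mixable shuffles by length -/

/-- The number of increasing maps from `Fin k` to `Fin N`. -/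
theorem card_orderEmbedding_fin (k N : ℕ) : Fintype.card (Fin k ↪o Fin N) = N.choose k := by
  have e : (Fin k ↪o Fin N) ≃ {t : Finset (Fin N) // t.card = k} :=
    { toFun f := ⟨Finset.univ.map f.toEmbedding, by simp⟩
      invFun t := t.1.orderEmbOfFin t.2
      left_inv f := by
        refine (Finset.orderEmbOfFin_unique' _ fun i => ?_).symm
        simp
      right_inv t := by
        ext j
        rw [← Finset.mem_coe, ← Finset.mem_coe, ← Finset.range_orderEmbOfFin t.1 t.2]
        simp }
  rw [Fintype.card_congr e]
  simp

/-- Both sides count pairs of increasing maps into `Fin N`; the bijection `split` sorts the pairs by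
the mixable shuffle they induce. -/
theorem sum_choose_len (m n N : ℕ) :
    ∑ s : MixableShuffle m n, N.choose s.len = N.choose m * N.choose n := by
  have h := Fintype.card_of_bijective
    ⟨split_injective (m := m) (n := n) N, split_surjective N⟩
  simpa [Fintype.card_sigma, card_orderEmbedding_fin] using h

/-- Take N = n: lengths are at least n, and those above n contribute zero. -/
theorem card_filter_len_eq_left (n : ℕ) :
    (Finset.univ.filter fun s : MixableShuffle 1 n => s.len = n).card = n := by
  have h := sum_choose_len 1 n n
  rw [Nat.choose_self, Nat.choose_one_right, mul_one] at h
  rw [Finset.card_filter]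
  refine Eq.trans (Finset.sum_congr rfl fun s _ => ?_) h
  symm
  rcases s.le_len_right.eq_or_lt with hl | hl
  · rw [if_pos hl.symm, ← hl, Nat.choose_self]
  · rw [if_neg hl.ne', Nat.choose_eq_zero_of_lt hl]

/-- Take N = n + 1: a shuffle of length n contributes n + 1 and one of length n + 1 contributes 1,
so the previous count determines this one. -/
theorem card_filter_len_eq_succ (n : ℕ) :
    (Finset.univ.filter fun s : MixableShuffle 1 n => s.len = n + 1).card = n + 1 := by
  have h := sum_choose_len 1 n (n + 1)
  have h2 : ∀ s : MixableShuffle 1 n, (n + 1).choose s.len =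
      (if s.len = n + 1 then 1 else 0) + (n + 1) * (if s.len = n then 1 else 0) := by
    intro s
    have h1 := s.le_len_right
    have h2 := s.len_le
    obtain hl | hl : s.len = n ∨ s.len = n + 1 := by omega
    · simp [hl]
    · simp [hl]
  rw [Finset.sum_congr rfl fun s _ => h2 s, Finset.sum_add_distrib, ← Finset.mul_sum,
    ← Finset.card_filter, ← Finset.card_filter, card_filter_len_eq_left,
    Nat.choose_one_right, Nat.choose_succ_self_right] at h
  linarith

end MixableShuffle

/-! ### Coordinates of tensors with respect to basis words -/

namespace TPow

open Module

variable {C : Type u} {A : Type v} [CommRing C] [CommRing A] [Algebra C A]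
variable {I : Type*} (b : Basis I C A)

/-- The coefficient in `A` of the basis word `w` under `A ⊗ A^{⊗ n} ≅ ⨁_w A`. -/
noncomputable def wordCoord {n : ℕ} (w : Fin n → I) : TPow C A (n + 1) →ₗ[C] A :=
  PiTensorProduct.lift ((MultilinearMap.mkPiAlgebra C (Fin (n + 1)) A).compLinearMap
    (Fin.cons LinearMap.id fun i => Algebra.linearMap C A ∘ₗ b.coord (w i)))

theorem wordCoord_tprod {n : ℕ} (w : Fin n → I) (a : Fin (n + 1) → A) :
    wordCoord b w (PiTensorProduct.tprod C a) =
      a 0 * ∏ i, algebraMap C A (b.coord (w i) (a i.succ)) := by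
  simp [wordCoord, Fin.prod_univ_succ]

/-- Through this comparison with the product basis, the coordinates in A inherit separation of
tensors and finiteness of support. -/
theorem repr_wordCoord {n : ℕ} (w : Fin n → I) (x : TPow C A (n + 1)) (i : I) :
    b.repr (wordCoord b w x) i =
      (Basis.piTensorProduct fun _ : Fin (n + 1) => b).repr x (Fin.cons i w : Fin (n + 1) → I) := by
  have : b.coord i ∘ₗ wordCoord b w =
      (Basis.piTensorProduct fun _ : Fin (n + 1) => b).coord (Fin.cons i w : Fin (n + 1) → I) := by
    refine PiTensorProduct.ext (MultilinearMap.ext fun a => ?_)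
    simp only [LinearMap.compMultilinearMap_apply, LinearMap.comp_apply, wordCoord_tprod,
      Basis.coord_apply, Basis.piTensorProduct_repr_tprod_apply, Fin.prod_univ_succ, Fin.cons_zero,
      Fin.cons_succ]
    rw [← map_prod, mul_comm, ← Algebra.smul_def, map_smul, Finsupp.smul_apply, smul_eq_mul,
      mul_comm]
  exact DFunLike.congr_fun this x

theorem exists_wordCoord_ne_zero {n : ℕ} {x : TPow C A (n + 1)} (hx : x ≠ 0) :
    ∃ w : Fin n → I, wordCoord b w x ≠ 0 := by
  by_contra! h
  refine hx ((Basis.piTensorProduct fun _ : Fin (n + 1) => b).ext_elem fun p => ?_)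
  rw [← Fin.cons_self_tail p, ← repr_wordCoord, h]
  simp

theorem finite_wordCoord_ne_zero {n : ℕ} (x : TPow C A (n + 1)) :
    {w : Fin n → I | wordCoord b w x ≠ 0}.Finite := by
  refine (((Basis.piTensorProduct fun _ : Fin (n + 1) => b).repr x).support.finite_toSet.image
    Fin.tail).subset fun w hw => ?_
  by_contra h
  refine hw (b.ext_elem fun i => ?_)
  rw [repr_wordCoord, map_zero, Finsupp.zero_apply]
  by_contra hne
  exact h ⟨Fin.cons i w, by simpa using hne, Fin.tail_cons _ _⟩

/-- A nonzero tensor has a leading word. -/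
theorem exists_leading_word [LinearOrder I] {n : ℕ} {x : TPow C A (n + 1)} (hx : x ≠ 0) :
    ∃ w : Fin n → I, wordCoord b w x ≠ 0 ∧
      ∀ w' : Fin n → I, wordCoord b w' x ≠ 0 → toLex w' ≤ toLex w := by
  obtain ⟨w, hw, hmax⟩ := Set.exists_max_image _ toLex (finite_wordCoord_ne_zero b x)
    (exists_wordCoord_ne_zero b hx)
  exact ⟨w, hw, hmax⟩

end TPow

/-! ### Coordinates of an unmerged shuffle -/

namespace MixableShuffle

open Module

variable {C : Type u} {A : Type v} [CommRing C] [CommRing A] [Algebra C A]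
variable {I : Type*} (b : Basis I C A) {m n : ℕ}

/-- Without merging every factor after the leading one is a single letter of one of the two words,
so the product of basis coordinates splits accordingly. -/
theorem wordCoord_prodTerm (s : MixableShuffle m n) (hs : s.T = ∅) (w : Fin s.len → I)
    (x : TPow C A (m + 1)) (y : TPow C A (n + 1)) :
    TPow.wordCoord b w (s.prodTerm x y) =
      TPow.wordCoord b (w ∘ s.left) x * TPow.wordCoord b (w ∘ s.right) y := by
  have key : s.prodTerm.compr₂ (TPow.wordCoord b w) =
      (LinearMap.mul C A).compl₁₂ (TPow.wordCoord b (w ∘ s.left))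
        (TPow.wordCoord b (w ∘ s.right)) := by
    refine PiTensorProduct.ext (MultilinearMap.ext fun x => PiTensorProduct.ext
      (MultilinearMap.ext fun y => ?_))
    have hword : ∀ k, s.word (Fin.tail x) (Fin.tail y) (s.block k) =
        Fin.append (Fin.tail x) (Fin.tail y) (s.perm k) := by
      intro k
      rw [word, Finset.prod_eq_single k]
      · intro l hl hne
        exact absurd (s.block_injective_of_T_eq_empty hs (Finset.mem_filter.1 hl).2) hne
      · simp
    change TPow.wordCoord b w (s.prodTerm (PiTensorProduct.tprod C x)
      (PiTensorProduct.tprod C y)) = TPow.wordCoord b _ (PiTensorProduct.tprod C x) *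
        TPow.wordCoord b _ (PiTensorProduct.tprod C y)
    rw [prodTerm_tprod, TPow.wordCoord_tprod, TPow.wordCoord_tprod, TPow.wordCoord_tprod]
    simp only [Fin.cons_zero, Fin.cons_succ]
    rw [← (Function.Bijective.prod_comp
      ⟨s.block_injective_of_T_eq_empty hs, s.block_surjective⟩ _),
      ← Equiv.prod_comp s.perm.symm, Fin.prod_univ_add]
    simp only [hword, Equiv.apply_symm_apply, Fin.append_left, Fin.append_right, Fin.tail,
      Function.comp_apply, left, right]
    ring
  exact DFunLike.congr_fun (DFunLike.congr_fun key x) y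

end MixableShuffle

/-! ### Homogeneous components of products -/

namespace Sha

open Module

variable {C : Type u} {A : Type v} [CommRing C] [CommRing A] [Algebra C A] {lam : C}

/-- Needed because `s.len` equals m + n only propositionally when nothing is merged. -/
theorem wordCoord_coeff_of {I : Type*} (b : Basis I C A) {k N : ℕ} (h : k = N) (w : Fin N → I)
    (z : TPow C A (k + 1)) :
    TPow.wordCoord b w (coeff C A lam N (of C A lam k z)) =
      TPow.wordCoord b (w ∘ Fin.cast h) z := by
  subst h
  rw [coeff_of_self]
  rfl

/-- Merged shuffles have length below m + n, and the remaining ones carry the factor `lam ^ 0`, so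
the weight disappears. -/
theorem wordCoord_coeff_add_of_mul_of {I : Type*} (b : Basis I C A) {m n : ℕ}
    (x : TPow C A (m + 1)) (y : TPow C A (n + 1)) (w : Fin (m + n) → I) :
    TPow.wordCoord b w (coeff C A lam (m + n) (of C A lam m x * of C A lam n y)) =
      ∑ s : MixableShuffle m n with s.T = ∅,
        TPow.wordCoord b (fun i => w (s.perm.symm (Fin.castAdd n i))) x *
          TPow.wordCoord b (fun i => w (s.perm.symm (Fin.natAdd m i))) y := by
  rw [of_mul_of, map_sum, map_sum, Finset.sum_filter]
  refine Finset.sum_congr rfl fun s _ => ?_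
  rw [map_smul, map_smul]
  split_ifs with hs
  · rw [wordCoord_coeff_of b (s.len_of_T_eq_empty hs), s.wordCoord_prodTerm b hs, hs,
      Finset.card_empty, pow_zero, one_smul]
    congr 3
    · ext i
      simp [MixableShuffle.left, s.block_of_T_eq_empty hs]
    · ext i
      simp [MixableShuffle.right, s.block_of_T_eq_empty hs]
  · rw [coeff_of_ne (s.len_lt_of_T_ne_empty hs).ne', map_zero, smul_zero]

theorem coeff_of_mul_of_of_add_lt {m n N : ℕ} (h : m + n < N) (x : TPow C A (m + 1))
    (y : TPow C A (n + 1)) : coeff C A lam N (of C A lam m x * of C A lam n y) = 0 := by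
  rw [of_mul_of, map_sum]
  refine Finset.sum_eq_zero fun s _ => ?_
  rw [map_smul, coeff_of_ne (s.len_le.trans_lt h).ne', smul_zero]

/-- In weight zero every merged shuffle has coefficient zero, so the product is graded. -/
theorem coeff_of_mul_of_weight_zero {m n N : ℕ} (h : N ≠ m + n) (x : TPow C A (m + 1))
    (y : TPow C A (n + 1)) : coeff C A 0 N (of C A 0 m x * of C A 0 n y) = 0 := by
  rw [of_mul_of, map_sum]
  refine Finset.sum_eq_zero fun s _ => ?_
  rw [map_smul]
  by_cases hs : s.T = ∅
  · rw [coeff_of_ne (by rwa [s.len_of_T_eq_empty hs]), smul_zero]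
  · rw [zero_pow (Finset.card_ne_zero.2 (Finset.nonempty_iff_ne_empty.2 hs)), zero_smul]

/-- Serves both extremes: the top components in any weight and the lowest components in weight zero.
-/
theorem coeff_mul_eq_single {x y : Sha C A lam} {m n N : ℕ}
    (h : ∀ k l, (k, l) ≠ (m, n) → coeff C A lam k x ≠ 0 → coeff C A lam l y ≠ 0 →
      coeff C A lam N (of C A lam k (coeff C A lam k x) * of C A lam l (coeff C A lam l y)) = 0) :
    coeff C A lam N (x * y) =
      coeff C A lam N (of C A lam m (coeff C A lam m x) * of C A lam n (coeff C A lam n y)) := by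
  obtain ⟨S, hS⟩ := exists_eq_sum x
  obtain ⟨S', hS'⟩ := exists_eq_sum y
  have hxm : m ∉ S → coeff C A lam m x = 0 := fun hm => by
    rw [hS, map_sum]
    exact Finset.sum_eq_zero fun k hk => coeff_of_ne (by rintro rfl; exact hm hk) _
  have hyn : n ∉ S' → coeff C A lam n y = 0 := fun hn => by
    rw [hS', map_sum]
    exact Finset.sum_eq_zero fun k hk => coeff_of_ne (by rintro rfl; exact hn hk) _
  conv_lhs => rw [hS, hS']
  rw [Finset.sum_mul_sum, ← Finset.sum_product', map_sum, Finset.sum_eq_single (m, n)]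
  · rintro ⟨k, l⟩ - hne
    by_cases hk : coeff C A lam k x = 0
    · simp only [hk, map_zero, zero_mul]
    by_cases hl : coeff C A lam l y = 0
    · simp only [hl, map_zero, mul_zero]
    exact h k l hne hk hl
  · intro hmn
    rw [Finset.mem_product, not_and_or] at hmn
    rcases hmn with hm | hn
    · simp only [hxm hm, map_zero, zero_mul]
    · simp only [hyn hn, map_zero, mul_zero]

end Sha

/-- The multiplication map to A sends this tensor to 1. -/
theorem onePow_ne_zero {C : Type u} {A : Type v} [CommRing C] [CommRing A] [Algebra C A]
    [Nontrivial A] (n : ℕ) : onePow C A n ≠ 0 := by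
  intro h
  have h1 := congrArg (PiTensorProduct.lift (MultilinearMap.mkPiAlgebra C (Fin n) A)) h
  rw [onePow, PiTensorProduct.lift.tprod, map_zero] at h1
  simp at h1

/-! ### Multiplication by 1^{⊗2}, and absence of zero divisors -/

namespace Sha

open Module

section CommRing

variable {C : Type u} {A : Type v} [CommRing C] [CommRing A] [Algebra C A] {lam : C}

theorem exists_coeff_ne_zero {x : Sha C A lam} (hx : x ≠ 0) : ∃ n, coeff C A lam n x ≠ 0 := by
  by_contra! h
  exact hx (ext_coeff fun k => by rw [h, map_zero])

theorem exists_top_coeff {x : Sha C A lam} (hx : x ≠ 0) :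
    ∃ m, coeff C A lam m x ≠ 0 ∧ ∀ k, coeff C A lam k x ≠ 0 → k ≤ m := by
  obtain ⟨S, hS⟩ := exists_eq_sum x
  have hfin : {k | coeff C A lam k x ≠ 0}.Finite := by
    refine S.finite_toSet.subset fun k hk => ?_
    by_contra hkS
    refine hk ?_
    rw [hS, map_sum]
    exact Finset.sum_eq_zero fun l hl => coeff_of_ne (by rintro rfl; exact hkS hl) _
  obtain ⟨m, hm, hmax⟩ := Set.exists_max_image _ id hfin (exists_coeff_ne_zero hx)
  exact ⟨m, hm, hmax⟩

theorem of_onePow_ne_zero [Nontrivial A] (n : ℕ) : of C A lam n (onePow C A (n + 1)) ≠ 0 := by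
  intro h
  have := congrArg (coeff C A lam n) h
  rw [coeff_of_self, map_zero] at this
  exact onePow_ne_zero (n + 1) this

theorem of_onePow_eq {k N : ℕ} (h : k = N) :
    of C A lam k (onePow C A (k + 1)) = of C A lam N (onePow C A (N + 1)) := by
  subst h
  rfl

/-- Every mixable shuffle of words of ones is again a word of ones, so only the number of shuffles
of each length and the weight matter. -/
theorem of_one_onePow_mul (n : ℕ) :
    of C A lam 1 (onePow C A 2) * of C A lam n (onePow C A (n + 1)) =
      (n + 1) • of C A lam (n + 1) (onePow C A (n + 2)) +
        n • lam • of C A lam n (onePow C A (n + 1)) := by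
  have h : ∀ s : MixableShuffle 1 n, lam ^ s.T.card • of C A lam s.len (PiTensorProduct.tprod C
        (Fin.cons (1 * 1) (s.word (Fin.tail fun _ => (1 : A)) (Fin.tail fun _ => (1 : A))) :
          Fin (s.len + 1) → A)) =
      (if s.len = n + 1 then of C A lam (n + 1) (onePow C A (n + 2)) else 0) +
        if s.len = n then lam • of C A lam n (onePow C A (n + 1)) else 0 := by
    intro s
    have hone : (Fin.cons (1 * 1) (s.word (Fin.tail fun _ => (1 : A)) (Fin.tail fun _ => (1 : A))) :
          Fin (s.len + 1) → A) = fun _ => 1 := by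
      ext j
      induction j using Fin.cases with
      | zero => simp
      | succ j => simp [MixableShuffle.word_apply, Fin.tail]
    have h1 := s.le_len_right
    have h2 := s.len_le
    have h3 := s.card_T_le
    have h4 : s.len = 1 + n - s.T.card := rfl
    rw [hone]
    change _ • of C A lam s.len (onePow C A (s.len + 1)) = _
    obtain hl | hl : s.len = n ∨ s.len = n + 1 := by omega
    · have hT : s.T.card = 1 := by omega
      rw [if_neg (by omega), if_pos hl, hT, pow_one, zero_add, of_onePow_eq hl]
    · have hT : s.T.card = 0 := by omega
      rw [if_pos hl, if_neg (by omega), hT, pow_zero, one_smul, add_zero, of_onePow_eq hl]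
  conv_lhs => rw [onePow, onePow, tprod_mul_tprod]
  rw [Finset.sum_congr rfl fun s _ => h s, Finset.sum_add_distrib, ← Finset.sum_filter,
    ← Finset.sum_filter, Finset.sum_const, Finset.sum_const,
    MixableShuffle.card_filter_len_eq_left, MixableShuffle.card_filter_len_eq_succ]

end CommRing

variable {C : Type u} {A : Type v} [Field C] [CharZero C] [CommRing A] [IsDomain A] [Algebra C A]
  {lam : C}

/-- The top component of a product of homogeneous elements is their shuffle product, and it does
not vanish. -/
theorem coeff_add_of_mul_of_ne_zero {m n : ℕ} {x : TPow C A (m + 1)} {y : TPow C A (n + 1)}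
    (hx : x ≠ 0) (hy : y ≠ 0) :
    coeff C A lam (m + n) (of C A lam m x * of C A lam n y) ≠ 0 := by
  let b := Basis.ofVectorSpace C A
  classical
  -- Any linear order would do: a tensor involves only finitely many words, so a largest one exists.
  let : LinearOrder (Basis.ofVectorSpaceIndex C A) := linearOrderOfSTO WellOrderingRel
  have : CharZero A := charZero_of_injective_algebraMap (algebraMap C A).injective
  obtain ⟨u, hu, humax⟩ := TPow.exists_leading_word b hx
  obtain ⟨v, hv, hvmax⟩ := TPow.exists_leading_word b hy
  have hne : (Finset.univ.filter fun s : MixableShuffle m n => s.T = ∅).Nonempty :=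
    ⟨MixableShuffle.concat m n, by simp [MixableShuffle.concat]⟩
  -- The word to inspect is the largest unmerged shuffle of the leading words.
  obtain ⟨s₀, hs₀, hmax⟩ := Finset.exists_max_image _ (fun s => toLex (s.interleave u v)) hne
  intro h0
  have h := wordCoord_coeff_add_of_mul_of (lam := lam) b x y (s₀.interleave u v)
  rw [h0, map_zero] at h
  -- If s contributes, the subwords it reads off are at most u and v, yet they interleave to a word
  -- no smaller than the s-interleaving of u and v. Hence they are u and v.
  have hterm : ∀ s ∈ Finset.univ.filter (fun s : MixableShuffle m n => s.T = ∅),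
      TPow.wordCoord b (fun i => s₀.interleave u v (s.perm.symm (Fin.castAdd n i))) x *
          TPow.wordCoord b (fun i => s₀.interleave u v (s.perm.symm (Fin.natAdd m i))) y =
        (if s.interleave u v = s₀.interleave u v then 1 else 0) *
          (TPow.wordCoord b u x * TPow.wordCoord b v y) := by
    intro s hs
    split_ifs with hss
    · rw [← hss]
      simp only [MixableShuffle.interleave_left, MixableShuffle.interleave_right, one_mul]
    · rw [zero_mul]
      by_contra hxy
      obtain ⟨hx', hy'⟩ := mul_ne_zero_iff.1 hxy
      have hr := s.interleave_restrict (s₀.interleave u v)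
      obtain ⟨h1, h2⟩ := s.eq_of_interleave_le (humax _ hx') (hvmax _ hy')
        (by rw [hr]; exact hmax s hs)
      rw [h1, h2] at hr
      exact hss hr
  rw [Finset.sum_congr rfl hterm, ← Finset.sum_mul, Finset.sum_boole] at h
  -- The multiplicity counts at least `s₀`, so it is nonzero in characteristic zero.
  refine mul_ne_zero ?_ (mul_ne_zero hu hv) h.symm
  rw [Nat.cast_ne_zero]
  exact Finset.card_ne_zero.2 ⟨s₀, Finset.mem_filter.2 ⟨hs₀, rfl⟩⟩

instance isDomain : IsDomain (Sha C A lam) := by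
  have : Nontrivial (Sha C A lam) := by
    refine ⟨1, 0, fun h => onePow_ne_zero (C := C) (A := A) 1 ?_⟩
    have := congrArg (coeff C A lam 0) h
    rwa [one_def, coeff_of_self, map_zero] at this
  have : NoZeroDivisors (Sha C A lam) := by
    refine ⟨fun {x y} hxy => ?_⟩
    by_contra! hne
    obtain ⟨m, hm, hmax⟩ := exists_top_coeff hne.1
    obtain ⟨n, hn, hnax⟩ := exists_top_coeff hne.2
    refine coeff_add_of_mul_of_ne_zero (lam := lam) hm hn ?_
    -- Any other pair of nonzero components has degree sum below m + n, and no product exceeds the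
    -- sum of the degrees.
    rw [← coeff_mul_eq_single, hxy, map_zero]
    intro k l hkl hk hl
    refine coeff_of_mul_of_of_add_lt ?_ _ _
    have h1 := hmax k hk
    have h2 := hnax l hl
    rw [Ne, Prod.mk.injEq] at hkl
    omega
  exact NoZeroDivisors.to_isDomain _

/-- The lowest components of two elements of weight zero have a nonzero product. -/
theorem mul_notMem_fil {x y : Sha C A 0} {j k : ℕ} (hx : x ∉ fil C A 0 j) (hy : y ∉ fil C A 0 k) :
    x * y ∉ fil C A 0 (j + k) := by
  classical
  have key : ∀ {z : Sha C A 0} {i : ℕ}, z ∉ fil C A 0 i →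
      ∃ m < i, coeff C A 0 m z ≠ 0 ∧ ∀ l < m, coeff C A 0 l z = 0 := by
    intro z i hz
    have : ∃ m, m < i ∧ coeff C A 0 m z ≠ 0 := by
      by_contra! h
      exact hz h
    obtain ⟨h1, h2⟩ := Nat.find_spec this
    refine ⟨Nat.find this, h1, h2, fun l hl => ?_⟩
    by_contra hne
    exact Nat.find_min this hl ⟨hl.trans h1, hne⟩
  obtain ⟨m, hmj, hm, hmin⟩ := key hx
  obtain ⟨n, hnk, hn, hnin⟩ := key hy
  intro h
  refine coeff_add_of_mul_of_ne_zero (lam := 0) hm hn ?_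
  rw [← coeff_mul_eq_single, h (m + n) (by omega)]
  -- Any other pair of nonzero components has degree sum above m + n, and in weight zero its product
  -- stays in that degree.
  intro p q hpq hp hq
  refine coeff_of_mul_of_weight_zero ?_ _ _
  have h1 : m ≤ p := not_lt.1 fun h => hp (hmin p h)
  have h2 : n ≤ q := not_lt.1 fun h => hq (hnin q h)
  rw [Ne, Prod.mk.injEq] at hpq
  omega

end Sha

/-! ### The completion -/

namespace ShaHat

section CommRing

variable {C : Type u} {A : Type v} [CommRing C] [CommRing A] [Algebra C A] {lam : C}

/-- A nonzero component in degree n is already visible modulo Fil^(n+1). -/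
theorem ofSha_ne_zero {x : Sha C A lam} (hx : x ≠ 0) : ofSha C A lam x ≠ 0 := by
  obtain ⟨n, hn⟩ := Sha.exists_coeff_ne_zero hx
  intro h
  have h1 : Ideal.Quotient.mk (Sha.fil C A lam (n + 1)) x = 0 :=
    congrFun (congrArg Subtype.val h) (n + 1)
  exact hn (Ideal.Quotient.eq_zero_iff_mem.1 h1 n (Nat.lt_succ_self n))

theorem series_ne_zero {a : ∀ n : ℕ, TPow C A (n + 1)} {n : ℕ} (ha : a n ≠ 0) :
    series lam a ≠ 0 := by
  intro h
  have h1 : Ideal.Quotient.mk (Sha.fil C A lam (n + 1))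
      (∑ i ∈ Finset.range (n + 1), Sha.of C A lam i (a i)) = 0 :=
    congrFun (congrArg Subtype.val h) (n + 1)
  have h2 := Ideal.Quotient.eq_zero_iff_mem.1 h1 n (Nat.lt_succ_self n)
  rw [map_sum, Finset.sum_eq_single_of_mem n (Finset.self_mem_range_succ n)
    fun i _ hi => Sha.coeff_of_ne hi.symm _, Sha.coeff_of_self] at h2
  exact ha h2

end CommRing

theorem ofSha_mul_series {C : Type u} {A : Type v} [Field C] [CommRing A] [Algebra C A] {lam : C}
    (hlam : lam ≠ 0) :
    ofSha C A lam (Sha.of C A lam 1 (onePow C A 2)) *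
      series lam (fun n => (-lam)⁻¹ ^ n • onePow C A (n + 1)) = 0 := by
  refine Subtype.ext (funext fun k => ?_)
  change Ideal.Quotient.mk (Sha.fil C A lam k) (Sha.of C A lam 1 (onePow C A 2)) *
    Ideal.Quotient.mk (Sha.fil C A lam k) (∑ n ∈ Finset.range k,
      Sha.of C A lam n ((-lam)⁻¹ ^ n • onePow C A (n + 1))) = 0
  set z := (-lam)⁻¹ with hz
  have hzl : z * lam = -1 := by rw [hz, inv_neg, neg_mul, inv_mul_cancel₀ hlam]
  -- `f n` is the degree n part of the n-th product. Since zλ = -1, the degree n + 1 part is -`f (n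
  -- + 1)`.
  let f : ℕ → Sha C A lam := fun n => (z ^ n * (n * lam)) • Sha.of C A lam n (onePow C A (n + 1))
  have hterm : ∀ n, Sha.of C A lam 1 (onePow C A 2) *
      Sha.of C A lam n (z ^ n • onePow C A (n + 1)) = f n - f (n + 1) := by
    intro n
    have hsmul : Sha.of C A lam 1 (onePow C A 2) * (z ^ n • Sha.of C A lam n (onePow C A (n + 1))) =
        z ^ n • (Sha.of C A lam 1 (onePow C A 2) * Sha.of C A lam n (onePow C A (n + 1))) :=
      map_smul (Sha.mulMap C A lam (Sha.of C A lam 1 (onePow C A 2))) _ _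
    have hc : z ^ (n + 1) * (((n + 1 : ℕ) : C) * lam) = -(z ^ n * ((n + 1 : ℕ) : C)) := by
      rw [pow_succ]
      linear_combination (z ^ n * ((n + 1 : ℕ) : C)) * hzl
    simp only [f]
    rw [map_smul, hsmul, Sha.of_one_onePow_mul, hc, neg_smul, sub_neg_eq_add, smul_add,
      ← Nat.cast_smul_eq_nsmul C, ← Nat.cast_smul_eq_nsmul C, smul_smul, smul_smul, smul_smul,
      add_comm]
    simp only [mul_assoc]
  rw [← map_mul, Ideal.Quotient.eq_zero_iff_mem, Finset.mul_sum,
    Finset.sum_congr rfl fun n _ => hterm n, Finset.sum_range_sub']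
  -- What remains is `f 0 - f k`: the first vanishes through its factor 0, the second lies in Fil^k.
  intro i hi
  simp only [f]
  rw [map_sub, map_smul, map_smul, Sha.coeff_of_ne hi.ne]
  simp

variable {C : Type u} {A : Type v} [Field C] [CharZero C] [CommRing A] [IsDomain A] [Algebra C A]

theorem isDomain_of_weight_zero : IsDomain (ShaHat C A (0 : C)) := by
  have : Nontrivial (ShaHat C A (0 : C)) :=
    ⟨1, 0, fun h => ofSha_ne_zero (one_ne_zero (α := Sha C A (0 : C))) (by rw [map_one, h])⟩
  -- Choose j with nonzero residue modulo Fil^j. By compatibility, representatives at all later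
  -- levels stay outside Fil^j.
  have key : ∀ {x : ShaHat C A (0 : C)}, x ≠ 0 → ∃ j, ∀ k, j ≤ k → ∀ X : Sha C A (0 : C),
      Ideal.Quotient.mk (Sha.fil C A 0 k) X = x.1 k → X ∉ Sha.fil C A 0 j := by
    intro x hx
    obtain ⟨j, hj⟩ : ∃ j, x.1 j ≠ 0 := by
      by_contra! h
      exact hx (Subtype.ext (funext h))
    refine ⟨j, fun k hjk X hX hmem => hj ?_⟩
    rw [← x.2 j k hjk, ← hX, Ideal.Quotient.factor_mk, Ideal.Quotient.eq_zero_iff_mem]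
    exact hmem
  have : NoZeroDivisors (ShaHat C A (0 : C)) := by
    refine ⟨fun {x y} hxy => ?_⟩
    by_contra! hne
    obtain ⟨j, hj⟩ := key hne.1
    obtain ⟨k, hk⟩ := key hne.2
    -- Level j + k is deep enough, since the product of the representatives is nonzero modulo
    -- Fil^(j+k).
    obtain ⟨X, hX⟩ := Ideal.Quotient.mk_surjective (x.1 (j + k))
    obtain ⟨Y, hY⟩ := Ideal.Quotient.mk_surjective (y.1 (j + k))
    refine Sha.mul_notMem_fil (hj _ (Nat.le_add_right j k) X hX)
      (hk _ (Nat.le_add_left k j) Y hY) ?_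
    rw [← Ideal.Quotient.eq_zero_iff_mem, map_mul, hX, hY]
    exact congrFun (congrArg Subtype.val hxy) (j + k)
  exact NoZeroDivisors.to_isDomain _

end ShaHat

theorem mainTheorem4 {C : Type u} {A : Type v} [Field C] [CharZero C] [CommRing A] [IsDomain A]
    [Algebra C A] :
    (∀ lam : C, IsDomain (Sha C A lam)) ∧
    (∀ lam : C, IsDomain (ShaHat C A lam) ↔ lam = 0) ∧
    (∀ lam : C, lam ≠ 0 →
      ShaHat.ofSha C A lam (Sha.of C A lam 1 (onePow C A 2)) ≠ 0 ∧
      ShaHat.series lam (fun n => (-lam)⁻¹ ^ n • onePow C A (n + 1)) ≠ 0 ∧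
      ShaHat.ofSha C A lam (Sha.of C A lam 1 (onePow C A 2)) *
        ShaHat.series lam (fun n => (-lam)⁻¹ ^ n • onePow C A (n + 1)) = 0) := by
  have hx : ∀ lam : C, ShaHat.ofSha C A lam (Sha.of C A lam 1 (onePow C A 2)) ≠ 0 := fun _ =>
    ShaHat.ofSha_ne_zero (Sha.of_onePow_ne_zero 1)
  have hy : ∀ lam : C,
      ShaHat.series lam (fun n => (-lam)⁻¹ ^ n • onePow C A (n + 1)) ≠ 0 := fun _ =>
    -- The degree 0 term of the series is 1 in any weight.
    ShaHat.series_ne_zero (n := 0) (by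
      rw [pow_zero, one_smul]
      exact onePow_ne_zero 1)
  refine ⟨fun _ => Sha.isDomain, fun lam => ⟨fun h => ?_, ?_⟩,
    fun lam hlam => ⟨hx lam, hy lam, ShaHat.ofSha_mul_series hlam⟩⟩
  · by_contra hlam
    exact (mul_ne_zero (hx lam) (hy lam)) (ShaHat.ofSha_mul_series hlam)
  · rintro rfl
    exact ShaHat.isDomain_of_weight_zero
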